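/- Let $a,b,c,d>0$ be real numbers with $$(a^2+ab)(b^2+ab)=(c^2+ab)(d^2+ab),$$ let $n\geq 1$ and $L=2n+1$. Let $V_0,V_1,\dots,V_L$ be copies of $\mathbb C^2$ with canonical basis $|{\uparrow}\rangle,|{\downarrow}\rangle$, and put $V^L=V_1\otimes\cdots\otimes V_L$. Let $R$ be the operator on $\mathbb C^2\otimes\mathbb C^2$ which in the basis $|{\uparrow\uparrow}\rangle,|{\uparrow\downarrow}\rangle,|{\downarrow\uparrow}\rangle,|{\downarrow\downarrow}\rangle$ is $$R=\begin{pmatrix}a&0&0&d\\0&b&c&0\\0&c&b&0\\d&0&0&a\end{pmatrix},$$ let $R_{0j}$ be the operator on $V_0\otimes V^L$ that acts as $R$ on $V_0\otimes V_j$ and as the identity on the other factors, and let $$\mathcal T=\operatorname{tr}_{V_0}\left(R_{0L}R_{0\,L-1}\cdots R_{01}\right):V^L\to V^L$$ be the transfer matrix of the eight-vertex model with vertex weights $a,b,c,d$, $L$ vertical lines and periodic boundary conditions along the horizontal direction. Then $\Theta_n=(a+b)^{2n+1}$ is the largest eigenvalue of $\mathcal T$: it is an eigenvalue of $\mathcal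 T$, and every other eigenvalue $\mu\in\mathbb C$ of $\mathcal T$ satisfies $|\mu|<\Theta_n$. -/

import Mathlib

namespace EightVertex

/-- The canonical basis of `V^L = ℂ² ⊗ ⋯ ⊗ ℂ²` is labelled by the spin configurations of `L` sites:
`0` stands for spin up and `1` for spin down. Vectors of `V^L` are functions
`SpinConfig L → K` (coordinates in the canonical basis), operators are matrices. -/
abbrev SpinConfig (L : ℕ) : Type := Fin L → Fin 2

/-- The `R`-matrix of the eight-vertex model on `K² ⊗ K²` with vertex weights `a, b, c, d`, in the
basis `↑↑, ↑↓, ↓↑, ↓↓` (the equivalence `finProdFinEquiv` sends `(i, j)` to `2 * i + j`). -/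
def RMatrix {K : Type*} [CommRing K] (a b c d : K) :
    Matrix (Fin 2 × Fin 2) (Fin 2 × Fin 2) K :=
  (!![a, 0, 0, d;
      0, b, c, 0;
      0, c, b, 0;
      d, 0, 0, a]).submatrix finProdFinEquiv finProdFinEquiv

/-- The operator `R_{0j}` on `V_0 ⊗ V^L`: it acts as the matrix `R` on the factors `V_0` and `V_j`
and as the identity on all the other factors. -/
def RSite {K : Type*} [CommRing K] {L : ℕ} (R : Matrix (Fin 2 × Fin 2) (Fin 2 × Fin 2) K)
    (j : Fin L) : Matrix (Fin 2 × SpinConfig L) (Fin 2 × SpinConfig L) K :=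
  fun p q => if ∀ k : Fin L, k ≠ j → p.2 k = q.2 k then R (p.1, p.2 j) (q.1, q.2 j) else 0

/-- The ordered product `R_{0L} R_{0L-1} ⋯ R_{01}` on `V_0 ⊗ V^L`. -/
def monodromyMatrix {K : Type*} [CommRing K] (L : ℕ) (a b c d : K) :
    Matrix (Fin 2 × SpinConfig L) (Fin 2 × SpinConfig L) K :=
  (List.ofFn fun j : Fin L => RSite (RMatrix a b c d) j).reverse.prod

/-- The partial trace over `V_0` of an operator on `V_0 ⊗ V^L`. -/
def partialTrace {K : Type*} [CommRing K] {L : ℕ}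
    (M : Matrix (Fin 2 × SpinConfig L) (Fin 2 × SpinConfig L) K) :
    Matrix (SpinConfig L) (SpinConfig L) K :=
  fun s s' => ∑ t : Fin 2, M (t, s) (t, s')

/-- The transfer matrix `tr_0 (R_{0L} R_{0L-1} ⋯ R_{01})` of the eight-vertex model with `L`
vertical lines and periodic boundary conditions along the horizontal direction. -/
def transferMatrix {K : Type*} [CommRing K] (L : ℕ) (a b c d : K) :
    Matrix (SpinConfig L) (SpinConfig L) K :=
  partialTrace (monodromyMatrix L a b c d)

end EightVertex

/-!
The proof exhibits two strictly positive product vectors between which every power of the transfer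
matrix `T` has an exactly computable matrix element. With `s = √(c d / (a b))` put `e = (1, s)`,
`f = (-1, s)`, and let `g` be the covector with `g e = 1`, `g f = 0`. Write `v = e ⊗ ⋯ ⊗ e` and
`φ = g ⊗ ⋯ ⊗ g`, with `L = 2 n + 1` factors. Then `φ (T ^ k v) = Θ ^ k` for all `k`, where
`Θ = (a + b) ^ L` (`dotProduct_transferMatrix_pow_mulVec`).

Indeed, reading the `k × L` lattice column by column, `φ (T ^ k v) = tr (C_k ^ L)`, where `C_k`
acts on `k` auxiliary spaces and is the `(e, e)` entry of a column of `k` vertices. In the basis `e, f`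
the relation between the weights says that the blocks of the `R`-matrix are built from idempotents:
divided by `a + b`, they are `P` from `e` to `e`, `1 - P` from `f` to `f`, `(1 - P) - G` from `e` to `f`
and `P - G'` from `f` to `e`, with `P, G, G'` of rank one. The affine recursion
`(X, Y) ↦ (P ⊗ (1 - X - Y) + G' ⊗ Y, (1 - P) ⊗ (1 - X - Y) + G ⊗ X)` preserves pairs of orthogonal
idempotents, and its linear part is minus the action of the vertex on a column. Starting it from
`(0, 0)` and from `(1, 0)` therefore displays `C_k` as `(-(a + b)) ^ k (X' - X)` with idempotents
`X, X'` and `tr (X' - X) = (-1) ^ k` (`exists_transferMatrix_pow_mulVec`). Odd powers of a difference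
of two idempotents all have the same trace (`trace_sub_pow_of_isIdempotentElem`), and `L` is odd.

The identity gives `p(Θ) = φ (p(T) v)` for every polynomial `p`. For the minimal polynomial of `T`
this shows that `Θ` is an eigenvalue (`hasEigenvalue_of_dotProduct_pow`). As the entries of `T` are
nonnegative and those of `φ`, `v` positive, the growth rate `Θ` bounds the spectral radius; as the
diagonal of `T` is positive, the same applies to `T - ε` and `Θ - ε` for some `ε > 0`, which excludes
other eigenvalues of modulus `Θ` (`norm_eigenvalue_lt_of_dotProduct_pow`).
-/

open Matrix
open scoped Kronecker

namespace EightVertex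

/-! ### Spectral bounds from power growth between two positive vectors -/

/-- If `T ≥ 0` entrywise and `φ (T ^ k v)` grows like `Θ ^ k` for a pair of strictly positive vectors,
then no complex eigenvalue of `T` exceeds `Θ` in modulus. -/
theorem norm_eigenvalue_le_of_dotProduct_pow {ι : Type*} [Fintype ι] [DecidableEq ι]
    {T : Matrix ι ι ℝ} (hT : ∀ i j, 0 ≤ T i j) {φ v : ι → ℝ} (hφ : ∀ i, 0 < φ i)
    (hv : ∀ i, 0 < v i) {Θ : ℝ} (hΘ : 0 ≤ Θ)
    (hpow : ∀ k : ℕ, φ ⬝ᵥ (T ^ k *ᵥ v) = Θ ^ k * (φ ⬝ᵥ v)) {μ : ℂ} {w : ι → ℂ} (hw : w ≠ 0)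
    (hμ : T.map Complex.ofReal *ᵥ w = μ • w) : ‖μ‖ ≤ Θ := by
  set z : ι → ℝ := fun i => ‖w i‖ with hz
  have hz0 : ∀ i, 0 ≤ z i := fun i => norm_nonneg _
  have hTz : ∀ i, ‖μ‖ * z i ≤ (T *ᵥ z) i := by
    intro i
    have h := congrFun hμ i
    rw [Pi.smul_apply, smul_eq_mul] at h
    rw [hz]
    dsimp only
    rw [← norm_mul, ← h]
    refine (norm_sum_le _ _).trans (le_of_eq ?_)
    refine Finset.sum_congr rfl fun j _ => ?_
    simp [Complex.norm_real, abs_of_nonneg (hT i j)]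
  have hψ : ∀ k : ℕ, ∀ i, 0 ≤ (φ ᵥ* T ^ k) i := by
    intro k
    induction k with
    | zero => intro i; simpa using (hφ i).le
    | succ k ih =>
      intro i
      rw [pow_succ, ← Matrix.vecMul_vecMul]
      exact Finset.sum_nonneg fun j _ => mul_nonneg (ih j) (hT j i)
  have hlow : ∀ k : ℕ, ‖μ‖ ^ k * (φ ⬝ᵥ z) ≤ (φ ᵥ* T ^ k) ⬝ᵥ z := by
    intro k
    induction k with
    | zero => simp
    | succ k ih =>
      calc ‖μ‖ ^ (k + 1) * (φ ⬝ᵥ z) = ‖μ‖ * (‖μ‖ ^ k * (φ ⬝ᵥ z)) := by ring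
        _ ≤ ‖μ‖ * ((φ ᵥ* T ^ k) ⬝ᵥ z) := mul_le_mul_of_nonneg_left ih (norm_nonneg _)
        _ = (φ ᵥ* T ^ k) ⬝ᵥ (‖μ‖ • z) := by rw [dotProduct_smul, smul_eq_mul]
        _ ≤ (φ ᵥ* T ^ k) ⬝ᵥ (T *ᵥ z) :=
            Finset.sum_le_sum fun i _ => mul_le_mul_of_nonneg_left (hTz i) (hψ k i)
        _ = (φ ᵥ* T ^ (k + 1)) ⬝ᵥ z := by
            rw [pow_succ, ← Matrix.vecMul_vecMul, Matrix.dotProduct_mulVec]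
  set m : ℝ := ∑ i, z i / v i with hm
  have hzm : ∀ i, z i ≤ m * v i := by
    intro i
    rw [← div_le_iff₀ (hv i)]
    exact Finset.single_le_sum (f := fun i => z i / v i)
      (fun j _ => div_nonneg (hz0 j) (hv j).le) (Finset.mem_univ i)
  have hup : ∀ k : ℕ, (φ ᵥ* T ^ k) ⬝ᵥ z ≤ Θ ^ k * (m * (φ ⬝ᵥ v)) := by
    intro k
    calc (φ ᵥ* T ^ k) ⬝ᵥ z ≤ (φ ᵥ* T ^ k) ⬝ᵥ (m • v) :=
          Finset.sum_le_sum fun i _ => mul_le_mul_of_nonneg_left (hzm i) (hψ k i)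
      _ = Θ ^ k * (m * (φ ⬝ᵥ v)) := by
          rw [dotProduct_smul, ← Matrix.dotProduct_mulVec, hpow, smul_eq_mul]; ring
  have hpos : 0 < φ ⬝ᵥ z := by
    obtain ⟨i, hi⟩ := Function.ne_iff.mp hw
    exact Finset.sum_pos' (fun j _ => mul_nonneg (hφ j).le (hz0 j))
      ⟨i, Finset.mem_univ i, mul_pos (hφ i) (norm_pos_iff.mpr hi)⟩
  by_contra! hlt
  have hμ0 : 0 < ‖μ‖ := hΘ.trans_lt hlt
  have hlim : Filter.Tendsto (fun k : ℕ => (Θ / ‖μ‖) ^ k * (m * (φ ⬝ᵥ v))) Filter.atTop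
      (nhds (0 * (m * (φ ⬝ᵥ v)))) :=
    (tendsto_pow_atTop_nhds_zero_of_lt_one (div_nonneg hΘ hμ0.le)
      ((div_lt_one hμ0).mpr hlt)).mul_const _
  have hge : φ ⬝ᵥ z ≤ 0 * (m * (φ ⬝ᵥ v)) := by
    refine ge_of_tendsto' hlim fun k => ?_
    rw [div_pow, div_mul_eq_mul_div, le_div_iff₀ (pow_pos hμ0 k), mul_comm]
    exact (hlow k).trans (hup k)
  linarith

/-- A polynomial in `T` sandwiched between `φ` and `v` only sees the value of the polynomial at
`Θ`. -/
theorem dotProduct_aeval_mulVec {ι R : Type*} [Fintype ι] [DecidableEq ι] [CommRing R]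
    {T : Matrix ι ι R} {φ v : ι → R} {Θ : R}
    (hpow : ∀ k : ℕ, φ ⬝ᵥ (T ^ k *ᵥ v) = Θ ^ k * (φ ⬝ᵥ v)) (p : Polynomial R) :
    φ ⬝ᵥ (Polynomial.aeval T p *ᵥ v) = p.eval Θ * (φ ⬝ᵥ v) := by
  induction p using Polynomial.induction_on' with
  | add p q hp hq =>
    rw [map_add, Matrix.add_mulVec, dotProduct_add, hp, hq, Polynomial.eval_add, add_mul]
  | monomial k r =>
    rw [Polynomial.aeval_monomial, ← Algebra.smul_def, Matrix.smul_mulVec, dotProduct_smul, hpow,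
      Polynomial.eval_monomial, smul_eq_mul, mul_assoc]

/-- The minimal polynomial of `T` vanishes at `Θ`. -/
theorem hasEigenvalue_of_dotProduct_pow {ι K : Type*} [Fintype ι] [DecidableEq ι] [Field K]
    {T : Matrix ι ι K} {φ v : ι → K} {Θ : K} (hφv : φ ⬝ᵥ v ≠ 0)
    (hpow : ∀ k : ℕ, φ ⬝ᵥ (T ^ k *ᵥ v) = Θ ^ k * (φ ⬝ᵥ v)) :
    Module.End.HasEigenvalue (Matrix.toLin' T) Θ := by
  refine Module.End.hasEigenvalue_of_isRoot ?_
  rw [Matrix.minpoly_toLin']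
  have h := dotProduct_aeval_mulVec hpow (minpoly K T)
  rw [minpoly.aeval, Matrix.zero_mulVec, dotProduct_zero] at h
  exact (mul_eq_zero.mp h.symm).resolve_right hφv

/-- Strict dominance of `Θ`. With a positive diagonal, `T - ε` is still entrywise nonnegative for some
`ε > 0`, and the polynomial identity `φ ((T - ε) ^ k v) = (Θ - ε) ^ k φ v` puts the spectrum of `T`
into the disc of centre `ε` and radius `Θ - ε`, which meets the circle `|z| = Θ` only at `Θ`. -/
theorem norm_eigenvalue_lt_of_dotProduct_pow {ι : Type*} [Fintype ι] [DecidableEq ι] [Nonempty ι]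
    {T : Matrix ι ι ℝ} (hT : ∀ i j, 0 ≤ T i j) (hdiag : ∀ i, 0 < T i i) {φ v : ι → ℝ}
    (hφ : ∀ i, 0 < φ i) (hv : ∀ i, 0 < v i) {Θ : ℝ}
    (hpow : ∀ k : ℕ, φ ⬝ᵥ (T ^ k *ᵥ v) = Θ ^ k * (φ ⬝ᵥ v)) {μ : ℂ}
    (hμ : Module.End.HasEigenvalue (Matrix.toLin' (T.map Complex.ofReal)) μ) (hne : μ ≠ Θ) :
    ‖μ‖ < Θ := by
  obtain ⟨w, hw⟩ := hμ.exists_hasEigenvector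
  have hw1 : T.map Complex.ofReal *ᵥ w = μ • w := by simpa using hw.apply_eq_smul
  obtain ⟨i₀, hi₀⟩ := Finite.exists_min fun i => T i i
  set ε : ℝ := T i₀ i₀ with hε
  have hε0 : 0 < ε := hdiag i₀
  have hS : ∀ i j, 0 ≤ (T - ε • (1 : Matrix ι ι ℝ)) i j := by
    intro i j
    rw [Matrix.sub_apply, Matrix.smul_apply, Matrix.one_apply]
    split_ifs with h
    · subst h; simpa using hi₀ i
    · simpa using hT i j
  have hSpow : ∀ k : ℕ, φ ⬝ᵥ ((T - ε • (1 : Matrix ι ι ℝ)) ^ k *ᵥ v)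
      = (Θ - ε) ^ k * (φ ⬝ᵥ v) := by
    intro k
    have h := dotProduct_aeval_mulVec hpow ((Polynomial.X - Polynomial.C ε) ^ k)
    simpa [Algebra.algebraMap_eq_smul_one] using h
  have hφv : 0 < φ ⬝ᵥ v :=
    Finset.sum_pos (fun i _ => mul_pos (hφ i) (hv i)) Finset.univ_nonempty
  have hΘε : 0 ≤ Θ - ε := by
    have h := hSpow 1
    rw [pow_one, pow_one] at h
    refine nonneg_of_mul_nonneg_left (h ▸ ?_) hφv
    exact Finset.sum_nonneg fun i _ => mul_nonneg (hφ i).le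
      (Finset.sum_nonneg fun j _ => mul_nonneg (hS i j) (hv j).le)
  have hle : ‖μ - ε‖ ≤ Θ - ε := by
    refine norm_eigenvalue_le_of_dotProduct_pow hS hφ hv hΘε hSpow hw.2 ?_
    have hmap : (T - ε • (1 : Matrix ι ι ℝ)).map Complex.ofReal
        = T.map Complex.ofReal - (ε : ℂ) • (1 : Matrix ι ι ℂ) := by
      ext i j
      by_cases h : i = j <;> simp [h]
    rw [hmap, Matrix.sub_mulVec, hw1, Matrix.smul_mulVec, Matrix.one_mulVec, sub_smul]
  -- A point `x + iy ≠ Θ` of this disc satisfies `x² + y² < Θ²`.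
  have hsq : (μ.re - ε) ^ 2 + μ.im ^ 2 ≤ (Θ - ε) ^ 2 := by
    have h := pow_le_pow_left₀ (norm_nonneg _) hle 2
    rw [Complex.sq_norm, Complex.normSq_apply] at h
    simp only [Complex.sub_re, Complex.ofReal_re, Complex.sub_im, Complex.ofReal_im] at h
    linarith
  have hre : μ.re < Θ := by
    refine lt_of_le_of_ne ?_ fun h => hne (Complex.ext (by simpa using h) ?_)
    · have := abs_le_of_sq_le_sq (a := μ.re - ε) (by nlinarith [sq_nonneg μ.im]) hΘε
      linarith [(abs_le.mp this).2]
    · rw [h] at hsq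
      have : μ.im ^ 2 ≤ 0 := by linarith
      simpa using pow_eq_zero_iff (two_ne_zero) |>.mp (le_antisymm this (sq_nonneg _))
  refine lt_of_pow_lt_pow_left₀ 2 (by linarith) ?_
  rw [Complex.sq_norm, Complex.normSq_apply]
  nlinarith

/-! ### Odd powers of a difference of idempotents -/

/-- For idempotents `A`, `B` the square `S = (A - B) ^ 2` commutes with both, and
`(A - B) ^ 3 = (A - B) - (A B A - B A B)`, where the trace of `S ^ m (A B A - B A B)` vanishes. -/
theorem trace_sub_pow_of_isIdempotentElem {I K : Type*} [Fintype I] [DecidableEq I] [CommRing K]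
    {A B : Matrix I I K} (hA : A * A = A) (hB : B * B = B) (m : ℕ) :
    ((A - B) ^ (2 * m + 1)).trace = (A - B).trace := by
  induction m with
  | zero => simp
  | succ m ih =>
    rw [← ih]
    have hS : (A - B) ^ 2 = A + B - A * B - B * A := by
      rw [sq, sub_mul, mul_sub, mul_sub, hA, hB]; abel
    have hcA : Commute A ((A - B) ^ 2) := by
      rw [hS, commute_iff_eq]
      simp only [mul_add, mul_sub, add_mul, sub_mul, hA, mul_assoc]
      simp only [← mul_assoc A A, hA]
      abel
    have hcB : Commute B ((A - B) ^ 2) := by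
      rw [hS, commute_iff_eq]
      simp only [mul_add, mul_sub, add_mul, sub_mul, hB, mul_assoc]
      simp only [← mul_assoc B B, hB]
      abel
    have h3 : (A - B) ^ 2 * (A - B) = (A - B) - (A * B * A - B * A * B) := by
      rw [hS]
      simp only [mul_sub, add_mul, sub_mul, hA, hB, mul_assoc]
      abel
    have hpA : Commute A (((A - B) ^ 2) ^ m) := hcA.pow_right m
    have hpB : Commute B (((A - B) ^ 2) ^ m) := hcB.pow_right m
    set S := ((A - B) ^ 2) ^ m with hSdef
    have e1 : (S * (A * B * A)).trace = (S * (A * B)).trace := by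
      rw [← mul_assoc, trace_mul_comm, ← mul_assoc, hpA.eq, mul_assoc S, ← mul_assoc A A, hA]
    have e2 : (S * (B * A * B)).trace = (S * (A * B)).trace := by
      rw [← mul_assoc, trace_mul_comm, ← mul_assoc, hpB.eq, mul_assoc S, ← mul_assoc B B, hB,
        ← mul_assoc, trace_mul_comm, ← mul_assoc, hpA.eq, mul_assoc]
    have hexp : (A - B) ^ (2 * (m + 1) + 1) = S * ((A - B) ^ 2 * (A - B)) := by
      rw [hSdef, ← pow_mul, ← pow_succ, ← pow_add]; rfl
    have hexp' : (A - B) ^ (2 * m + 1) = S * (A - B) := by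
      rw [hSdef, ← pow_mul, ← pow_succ]
    rw [hexp, h3, mul_sub, mul_sub S (A * B * A), trace_sub, trace_sub (S * (A * B * A)), e1, e2,
      sub_self, sub_zero, hexp']

/-! ### Matrix product states and the action of the transfer matrix -/

/-- Products over the sites of a chain distribute over sums of the local factors. -/
theorem sum_prod_ofFn {κ A : Type*} [Fintype κ] [DecidableEq κ] [Semiring A] {L : ℕ}
    (f : Fin L → κ → A) :
    ∑ s : Fin L → κ, (List.ofFn fun j => f j (s j)).prod = (List.ofFn fun j => ∑ τ, f j τ).prod := by
  have h := (MultilinearMap.mkPiAlgebraFin ℕ L A).map_sum (α := fun _ => κ) (g := f)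
  simpa only [MultilinearMap.mkPiAlgebraFin_apply] using h.symm

theorem prod_ofFn_kronecker {I J K : Type*} [Fintype I] [DecidableEq I] [Fintype J]
    [DecidableEq J] [CommRing K] {L : ℕ} (A : Fin L → Matrix I I K) (B : Fin L → Matrix J J K) :
    (List.ofFn A).prod ⊗ₖ (List.ofFn B).prod = (List.ofFn fun j => A j ⊗ₖ B j).prod := by
  induction L with
  | zero => simp
  | succ L ih => simp only [List.ofFn_succ, List.prod_cons, Matrix.mul_kronecker_mul, ih]

/-- The matrix product state of `V^L` with local matrices `x 0`, `x 1` on the bond space `K^I`. -/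
def matrixProductState {I K : Type*} [Fintype I] [DecidableEq I] [CommRing K] (L : ℕ)
    (x : Fin 2 → Matrix I I K) : SpinConfig L → K :=
  fun s => (List.ofFn fun j => x (s j)).prod.trace

/-- The block `(σ, τ)` of the `R`-matrix with respect to the vertical spins, as a matrix on the
auxiliary space `V_0`. It is transposed, so that products over the sites run from left to right. -/
def auxBlock {K : Type*} [CommRing K] (a b c d : K) (σ τ : Fin 2) : Matrix (Fin 2) (Fin 2) K :=
  Matrix.of fun t t' => RMatrix a b c d (t', σ) (t, τ)

/-- The matrix entries of a product of operators `R_{0j}` over distinct sites: outside these sites the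
configuration is unchanged, and every site `j` contributes its block of `R` on `V_0`. -/
theorem prod_RSite_apply {K : Type*} [CommRing K] {L : ℕ}
    (R : Matrix (Fin 2 × Fin 2) (Fin 2 × Fin 2) K) (l : List (Fin L)) (hl : l.Nodup)
    (t t' : Fin 2) (s s' : SpinConfig L) :
    (l.map (RSite R)).prod (t, s) (t', s') = if ∀ k, k ∉ l → s k = s' k then
      (l.map fun j => Matrix.of fun u u' => R (u, s j) (u', s' j)).prod t t' else 0 := by
  induction l generalizing t s with
  | nil =>
    simp [Matrix.one_apply, Prod.ext_iff, funext_iff]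
    split_ifs <;> simp_all
  | cons j l ih =>
    obtain ⟨hj, hl⟩ := List.nodup_cons.mp hl
    rw [List.map_cons, List.prod_cons, List.map_cons, List.prod_cons, Matrix.mul_apply,
      Fintype.sum_prod_type]
    simp only [ih hl]
    -- The only intermediate configuration with a nonzero weight replaces `s j` by `s' j`.
    have key : ∀ u : Fin 2, (∑ r : SpinConfig L, RSite R j (t, s) (u, r) *
        if ∀ k, k ∉ l → r k = s' k then
          (l.map fun j => Matrix.of fun u u' => R (u, r j) (u', s' j)).prod u t' else 0)
        = if ∀ k, k ∉ j :: l → s k = s' k then R (t, s j) (u, s' j) *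
          (l.map fun j => Matrix.of fun u u' => R (u, s j) (u', s' j)).prod u t' else 0 := by
      intro u
      rw [Finset.sum_eq_single (Function.update s j (s' j))]
      · have h1 : RSite R j (t, s) (u, Function.update s j (s' j)) = R (t, s j) (u, s' j) := by
          rw [RSite, if_pos]
          · simp only [Function.update_self]
          intro k hk
          exact (Function.update_of_ne hk _ _).symm
        have h2 : (l.map fun i => Matrix.of fun u u' =>
            R (u, Function.update s j (s' j) i) (u', s' i))
            = l.map fun i => Matrix.of fun u u' => R (u, s i) (u', s' i) := by
          refine List.map_congr_left fun i hi => ?_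
          rw [Function.update_of_ne (ne_of_mem_of_not_mem hi hj)]
        have h3 : (∀ k, k ∉ l → Function.update s j (s' j) k = s' k)
            ↔ ∀ k, k ∉ j :: l → s k = s' k := by
          refine forall_congr' fun k => ?_
          by_cases hk : k = j
          · subst hk; simp
          · simp [hk]
        rw [h1, h2]
        simp only [h3, mul_ite, mul_zero]
      · intro r _ hr
        rw [RSite]
        split_ifs with h1 h2
        · refine absurd (funext fun k => ?_) hr
          by_cases hk : k = j
          · subst hk; rw [Function.update_self]; exact h2 _ hj
          · rw [Function.update_of_ne hk]; exact (h1 k hk).symm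
        all_goals simp
      · simp
    simp only [key]
    split_ifs with h
    · simp only [Matrix.mul_apply, Matrix.of_apply]
    · simp

/-- The entries of the transfer matrix are traces of products of auxiliary blocks. -/
theorem transferMatrix_apply {K : Type*} [CommRing K] (L : ℕ) (a b c d : K) (s s' : SpinConfig L) :
    transferMatrix L a b c d s s'
      = (List.ofFn fun j => auxBlock a b c d (s j) (s' j)).prod.trace := by
  have h : ∀ t, monodromyMatrix L a b c d (t, s) (t, s')
      = (List.ofFn fun j => auxBlock a b c d (s j) (s' j)).prod t t := by
    intro t
    rw [monodromyMatrix, List.ofFn_eq_map, ← List.map_reverse, prod_RSite_apply _ _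
      (List.nodup_reverse.mpr (List.nodup_finRange L)), if_pos (by simp),
      ← Matrix.transpose_apply (List.prod _), Matrix.transpose_list_prod, List.map_map,
      ← List.map_reverse, List.reverse_reverse, List.ofFn_eq_map]
    rfl
  simp only [transferMatrix, partialTrace, h, Matrix.trace, Matrix.diag_apply]

/-- The transfer matrix maps matrix product states to matrix product states, with the bond space
enlarged by one copy of `V_0`. -/
theorem transferMatrix_mulVec_matrixProductState {I K : Type*} [Fintype I] [DecidableEq I]
    [CommRing K] (L : ℕ) (a b c d : K) (x : Fin 2 → Matrix I I K) :
    transferMatrix L a b c d *ᵥ matrixProductState L x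
      = matrixProductState L fun σ => ∑ τ, auxBlock a b c d σ τ ⊗ₖ x τ := by
  ext s
  simp only [Matrix.mulVec, dotProduct, matrixProductState, transferMatrix_apply]
  simp only [← Matrix.trace_kronecker, prod_ofFn_kronecker, ← Matrix.trace_sum]
  rw [sum_prod_ofFn fun j τ => auxBlock a b c d (s j) τ ⊗ₖ x τ]

theorem dotProduct_matrixProductState {I K : Type*} [Fintype I] [DecidableEq I] [CommRing K]
    (L : ℕ) (g : Fin 2 → K) (x : Fin 2 → Matrix I I K) :
    (fun s : SpinConfig L => ∏ j, g (s j)) ⬝ᵥ matrixProductState L x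
      = ((∑ σ, g σ • x σ) ^ L).trace := by
  have h : ∀ s : SpinConfig L, (∏ j, g (s j)) • (List.ofFn fun j => x (s j)).prod
      = (List.ofFn fun j => g (s j) • x (s j)).prod := fun s => by
    simpa only [MultilinearMap.mkPiAlgebraFin_apply] using
      ((MultilinearMap.mkPiAlgebraFin K L (Matrix I I K)).map_smul_univ
        (fun j => g (s j)) (fun j => x (s j))).symm
  simp only [dotProduct, matrixProductState, ← smul_eq_mul, ← Matrix.trace_smul,
    ← Matrix.trace_sum, h]
  rw [sum_prod_ofFn fun _ σ => g σ • x σ, List.ofFn_const, List.prod_replicate]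

/-! ### Positivity of the transfer matrix -/

/-- Entrywise nonnegative matrices with a positive upper left entry are closed under products. -/
theorem list_prod_nonneg_and_pos {l : List (Matrix (Fin 2) (Fin 2) ℝ)}
    (hl : ∀ A ∈ l, ∀ i j, 0 ≤ A i j) :
    (∀ i j, 0 ≤ l.prod i j) ∧ ((∀ A ∈ l, 0 < A 0 0) → 0 < l.prod 0 0) := by
  induction l with
  | nil =>
    refine ⟨fun i j => ?_, fun _ => by simp⟩
    rw [List.prod_nil, Matrix.one_apply]
    split_ifs <;> norm_num
  | cons A l ih =>
    obtain ⟨hA, hl⟩ := List.forall_mem_cons.mp hl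
    obtain ⟨h1, h2⟩ := ih hl
    refine ⟨fun i j => ?_, fun h => ?_⟩
    · rw [List.prod_cons, Matrix.mul_apply]
      exact Finset.sum_nonneg fun k _ => mul_nonneg (hA i k) (h1 k j)
    · obtain ⟨h3, h4⟩ := List.forall_mem_cons.mp h
      rw [List.prod_cons, Matrix.mul_apply, Fin.sum_univ_two]
      exact add_pos_of_pos_of_nonneg (mul_pos h3 (h2 h4)) (mul_nonneg (hA 0 1) (h1 1 0))

theorem auxBlock_zero_zero {K : Type*} [CommRing K] (a b c d : K) :
    auxBlock a b c d 0 0 = !![a, 0; 0, b] := by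
  ext i j; fin_cases i <;> fin_cases j <;> rfl

theorem auxBlock_zero_one {K : Type*} [CommRing K] (a b c d : K) :
    auxBlock a b c d 0 1 = !![0, c; d, 0] := by
  ext i j; fin_cases i <;> fin_cases j <;> rfl

theorem auxBlock_one_zero {K : Type*} [CommRing K] (a b c d : K) :
    auxBlock a b c d 1 0 = !![0, d; c, 0] := by
  ext i j; fin_cases i <;> fin_cases j <;> rfl

theorem auxBlock_one_one {K : Type*} [CommRing K] (a b c d : K) :
    auxBlock a b c d 1 1 = !![b, 0; 0, a] := by
  ext i j; fin_cases i <;> fin_cases j <;> rfl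

theorem auxBlock_nonneg {a b c d : ℝ} (ha : 0 < a) (hb : 0 < b) (hc : 0 < c) (hd : 0 < d)
    (σ τ i j : Fin 2) : 0 ≤ auxBlock a b c d σ τ i j := by
  fin_cases σ <;> fin_cases τ <;> fin_cases i <;> fin_cases j <;>
    simp [auxBlock_zero_zero, auxBlock_zero_one, auxBlock_one_zero, auxBlock_one_one, ha.le, hb.le,
      hc.le, hd.le]

theorem transferMatrix_nonneg {a b c d : ℝ} (ha : 0 < a) (hb : 0 < b) (hc : 0 < c) (hd : 0 < d)
    (L : ℕ) (s s' : SpinConfig L) : 0 ≤ transferMatrix L a b c d s s' := by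
  rw [transferMatrix_apply]
  refine Finset.sum_nonneg fun t _ => (list_prod_nonneg_and_pos ?_).1 t t
  simpa [List.mem_ofFn] using fun k => auxBlock_nonneg ha hb hc hd _ _

theorem transferMatrix_diag_pos {a b c d : ℝ} (ha : 0 < a) (hb : 0 < b) (hc : 0 < c) (hd : 0 < d)
    (L : ℕ) (s : SpinConfig L) : 0 < transferMatrix L a b c d s s := by
  have h0 : ∀ A ∈ List.ofFn fun j => auxBlock a b c d (s j) (s j), ∀ i j, 0 ≤ A i j := by
    simpa [List.mem_ofFn] using fun k => auxBlock_nonneg ha hb hc hd _ _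
  obtain ⟨h1, h2⟩ := list_prod_nonneg_and_pos h0
  rw [transferMatrix_apply, Matrix.trace_fin_two]
  refine add_pos_of_pos_of_nonneg (h2 ?_) (h1 1 1)
  simp only [List.mem_ofFn, forall_exists_index, forall_apply_eq_imp_iff]
  intro j
  generalize s j = σ
  fin_cases σ
  · simpa [auxBlock_zero_zero] using ha
  · simpa [auxBlock_one_one] using hb

theorem transferMatrix_map {K K' : Type*} [CommRing K] [CommRing K'] (f : K →+* K') (L : ℕ)
    (a b c d : K) : (transferMatrix L a b c d).map f = transferMatrix L (f a) (f b) (f c) (f d) := by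
  have h : ∀ σ τ, (auxBlock a b c d σ τ).map f = auxBlock (f a) (f b) (f c) (f d) σ τ := by
    intro σ τ
    ext i j
    fin_cases σ <;> fin_cases τ <;> fin_cases i <;> fin_cases j <;>
      simp [auxBlock_zero_zero, auxBlock_zero_one, auxBlock_one_zero, auxBlock_one_one]
  ext s s'
  rw [Matrix.map_apply, transferMatrix_apply, transferMatrix_apply, AddMonoidHom.map_trace,
    ← RingHom.mapMatrix_apply, map_list_prod, List.map_ofFn]
  congr 3
  ext1 j
  exact h _ _

/-! ### Pairs of orthogonal idempotents on the auxiliary spaces -/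

/-- A pair of mutually orthogonal idempotents of a ring. -/
structure IsOrthogonalPair {A : Type*} [Ring A] (X Y : A) : Prop where
  left_idem : X * X = X
  right_idem : Y * Y = Y
  left_right : X * Y = 0
  right_left : Y * X = 0

/-- Adjoining one more auxiliary space, with idempotents `P`, `G`, `G'` on it, to a pair of orthogonal
idempotents. The summands live on the mutually orthogonal ranges of `1 - X - Y`, `X` and `Y`. -/
theorem IsOrthogonalPair.kronecker {I J K : Type*} [Fintype I] [DecidableEq I] [Fintype J]
    [DecidableEq J] [CommRing K] {P G G' : Matrix J J K} (hP : P * P = P) (hG : G * G = G)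
    (hG' : G' * G' = G') {X Y : Matrix I I K} (h : IsOrthogonalPair X Y) :
    IsOrthogonalPair (P ⊗ₖ (1 - X - Y) + G' ⊗ₖ Y) ((1 - P) ⊗ₖ (1 - X - Y) + G ⊗ₖ X) := by
  obtain ⟨hX, hY, hXY, hYX⟩ := h
  have hU : (1 - X - Y) * (1 - X - Y) = 1 - X - Y := by
    simp only [mul_sub, sub_mul, mul_one, one_mul, hX, hY, hXY, hYX]; abel
  have hUX : (1 - X - Y) * X = 0 := by simp only [sub_mul, one_mul, hX, hYX]; abel
  have hXU : X * (1 - X - Y) = 0 := by simp only [mul_sub, mul_one, hX, hXY]; abel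
  have hUY : (1 - X - Y) * Y = 0 := by simp only [sub_mul, one_mul, hY, hXY]; abel
  have hYU : Y * (1 - X - Y) = 0 := by simp only [mul_sub, mul_one, hY, hYX]; abel
  have hP1 : P * (1 - P) = 0 := by rw [mul_sub, mul_one, hP, sub_self]
  have hP2 : (1 - P) * P = 0 := by rw [sub_mul, one_mul, hP, sub_self]
  have hP3 : (1 - P) * (1 - P) = 1 - P := by rw [mul_sub, mul_one, hP2, sub_zero]
  constructor <;>
    simp only [add_mul, mul_add, ← Matrix.mul_kronecker_mul, hU, hUX, hXU, hUY, hYU, hX, hY, hXY,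
      hYX, hP, hG, hG', hP1, hP2, hP3, Matrix.kronecker_zero, Matrix.zero_kronecker, add_zero,
      zero_add]

theorem mul_self_eq_self_of_fin_two {K : Type*} [Field K] {x y z w : K} (htr : x + w = 1)
    (hdet : x * w = y * z) : !![x, y; z, w] * !![x, y; z, w] = !![x, y; z, w] := by
  have hw : w = 1 - x := by linear_combination htr
  subst hw
  rw [Matrix.mul_fin_two]
  have h1 : x * x + y * z = x := by linear_combination -hdet
  have h2 : x * y + y * (1 - x) = y := by ring
  have h3 : z * x + (1 - x) * z = z := by ring
  have h4 : z * y + (1 - x) * (1 - x) = 1 - x := by linear_combination -hdet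
  rw [h1, h2, h3, h4]

/-! ### The dominant growth rate -/

/-- Let `e = (1, s)` and `f = (-1, s)` be vertical spin vectors. `idemP` is the block of the
`R`-matrix from `e` to `e` in the basis `(e, f)`, divided by `a + b`, as a matrix on `V_0`
(transposed as in `auxBlock`). The block from `f` to `f` is `1 - idemP`. -/
noncomputable def idemP (a b c d s : ℝ) : Matrix (Fin 2) (Fin 2) ℝ :=
  !![1 / 2, (s * c + d / s) / (2 * (a + b)); (s * d + c / s) / (2 * (a + b)), 1 / 2]

/-- The idempotents on `V_0` that determine the off-diagonal blocks of the `R`-matrix in the basis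
`e = (1, s)`, `f = (-1, s)`: divided by `a + b`, the block from `e` to `f` is
`(1 - idemP) - idemG (-1)`, and the block from `f` to `e` is `idemP - idemG 1`. -/
noncomputable def idemG (a b c d s ε : ℝ) : Matrix (Fin 2) (Fin 2) ℝ :=
  !![a / (a + b), ε * d / (s * (a + b)); ε * c / (s * (a + b)), b / (a + b)]

/-- `idemP` has trace `1`; the vanishing of its determinant is the relation between the weights. -/
theorem idemP_mul_self {a b c d s : ℝ} (ha : 0 < a) (hb : 0 < b) (hs : 0 < s)
    (hsq : s ^ 2 * (a * b) = c * d)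
    (hsusy : (a ^ 2 + a * b) * (b ^ 2 + a * b) = (c ^ 2 + a * b) * (d ^ 2 + a * b)) :
    idemP a b c d s * idemP a b c d s = idemP a b c d s := by
  refine mul_self_eq_self_of_fin_two (by norm_num) ?_
  have hab : a + b ≠ 0 := by positivity
  have key : (s * c + d / s) * (s * d + c / s) = (a + b) ^ 2 := by
    have h : (s ^ 2 * c + d) * (s ^ 2 * d + c) = s ^ 2 * (a + b) ^ 2 := by
      have hab' : a * b ≠ 0 := by positivity
      apply mul_left_cancel₀ hab'
      linear_combination (c * d * s ^ 2 - a * b) * hsq - s ^ 2 * hsusy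
    field_simp
    linear_combination h
  rw [div_mul_div_comm (s * c + d / s), key]
  field_simp

theorem idemG_mul_self {a b c d s ε : ℝ} (ha : 0 < a) (hb : 0 < b) (hs : 0 < s) (hε : ε ^ 2 = 1)
    (hsq : s ^ 2 * (a * b) = c * d) :
    idemG a b c d s ε * idemG a b c d s ε = idemG a b c d s ε := by
  have hab : a + b ≠ 0 := by positivity
  refine mul_self_eq_self_of_fin_two (by field_simp) ?_
  field_simp
  linear_combination hsq - c * d * hε

/-- The action of the `R`-matrix on the vector `(1, s)` of the vertical space. -/
theorem auxBlock_add (a b c d : ℝ) {s : ℝ} (hab : a + b ≠ 0) (hs : s ≠ 0) (σ : Fin 2) :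
    auxBlock a b c d σ 0 + s • auxBlock a b c d σ 1
      = (a + b) • (![1, s] σ • idemP a b c d s
        + ![-1, s] σ • (1 - idemP a b c d s - idemG a b c d s (-1))) := by
  ext i j
  fin_cases σ <;> fin_cases i <;> fin_cases j <;>
    simp [auxBlock_zero_zero, auxBlock_zero_one, auxBlock_one_zero, auxBlock_one_one, idemP,
      idemG] <;>
    field_simp <;> ring

/-- The action of the `R`-matrix on the vector `(-1, s)` of the vertical space. -/
theorem auxBlock_neg_add (a b c d : ℝ) {s : ℝ} (hab : a + b ≠ 0) (hs : s ≠ 0) (σ : Fin 2) :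
    -auxBlock a b c d σ 0 + s • auxBlock a b c d σ 1
      = (a + b) • (![1, s] σ • (idemP a b c d s - idemG a b c d s 1)
        + ![-1, s] σ • (1 - idemP a b c d s)) := by
  ext i j
  fin_cases σ <;> fin_cases i <;> fin_cases j <;>
    simp [auxBlock_zero_zero, auxBlock_zero_one, auxBlock_one_zero, auxBlock_one_one, idemP,
      idemG] <;>
    field_simp <;> ring

/-- The local matrices `e ⊗ D + f ⊗ E` with `e = (1, s)` and `f = (-1, s)`. -/
def localMatrix {I : Type} (s : ℝ) (D E : Matrix I I ℝ) (σ : Fin 2) : Matrix I I ℝ :=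
  ![1, s] σ • D + ![-1, s] σ • E

theorem sum_auxBlock_kronecker_localMatrix {I : Type} [Fintype I] [DecidableEq I] (a b c d : ℝ)
    {s : ℝ} (hab : a + b ≠ 0) (hs : s ≠ 0) (D E : Matrix I I ℝ) (σ : Fin 2) :
    ∑ τ, auxBlock a b c d σ τ ⊗ₖ localMatrix s D E τ
      = (a + b) • localMatrix s
        (idemP a b c d s ⊗ₖ D + (idemP a b c d s - idemG a b c d s 1) ⊗ₖ E)
        ((1 - idemP a b c d s - idemG a b c d s (-1)) ⊗ₖ D + (1 - idemP a b c d s) ⊗ₖ E) σ := by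
  have h : ∑ τ, auxBlock a b c d σ τ ⊗ₖ localMatrix s D E τ
      = (auxBlock a b c d σ 0 + s • auxBlock a b c d σ 1) ⊗ₖ D
        + (-auxBlock a b c d σ 0 + s • auxBlock a b c d σ 1) ⊗ₖ E := by
    ext i j
    simp [Fin.sum_univ_two, localMatrix, Matrix.kroneckerMap_apply]
    ring
  rw [h, auxBlock_add a b c d hab hs, auxBlock_neg_add a b c d hab hs]
  ext i j
  simp [localMatrix, Matrix.kroneckerMap_apply]
  ring

/-- The product vector `(1, s) ⊗ ⋯ ⊗ (1, s)`. -/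
def productVec (L : ℕ) (s : ℝ) : SpinConfig L → ℝ := fun σ => ∏ j, ![1, s] (σ j)

/-- The product covector `g ⊗ ⋯ ⊗ g`, where `g` takes the value `1` on `(1, s)` and vanishes on
`(-1, s)`. -/
noncomputable def productCovec (L : ℕ) (s : ℝ) : SpinConfig L → ℝ :=
  fun σ => ∏ j, ![1 / 2, 1 / (2 * s)] (σ j)

/-- Every power of the transfer matrix maps `productVec` to a matrix product state whose local
matrices, in the basis `(1, s)`, `(-1, s)`, are differences of idempotents. The pairs `(X, Y)` and
`(X', Y')` obey the same affine recursion `IsOrthogonalPair.kronecker`, starting from `(0, 0)` and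
`(1, 0)`; its linear part is minus the vertical transfer divided by `a + b`. -/
theorem exists_transferMatrix_pow_mulVec {a b c d s : ℝ} (ha : 0 < a) (hb : 0 < b) (hs : 0 < s)
    (hsq : s ^ 2 * (a * b) = c * d)
    (hsusy : (a ^ 2 + a * b) * (b ^ 2 + a * b) = (c ^ 2 + a * b) * (d ^ 2 + a * b)) (L k : ℕ) :
    ∃ (I : Type) (_ : Fintype I) (_ : DecidableEq I) (X Y X' Y' : Matrix I I ℝ),
      IsOrthogonalPair X Y ∧ IsOrthogonalPair X' Y' ∧ (X' - X).trace = (-1) ^ k ∧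
      transferMatrix L a b c d ^ k *ᵥ productVec L s
        = matrixProductState L (localMatrix s ((-(a + b)) ^ k • (X' - X))
          ((-(a + b)) ^ k • (Y' - Y))) := by
  have hab : a + b ≠ 0 := by positivity
  induction k with
  | zero =>
    refine ⟨Unit, inferInstance, inferInstance, 0, 0, 1, 0, ⟨by simp, by simp, by simp, by simp⟩,
      ⟨by simp, by simp, by simp, by simp⟩, by simp, ?_⟩
    ext σ
    have h : ∀ τ, localMatrix s ((-(a + b)) ^ 0 • ((1 : Matrix Unit Unit ℝ) - 0))
        ((-(a + b)) ^ 0 • (0 - 0)) τ = Matrix.scalar Unit (![1, s] τ) := by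
      intro τ
      ext i j
      simp [localMatrix]
    simp only [matrixProductState, h]
    rw [← Function.comp_def (Matrix.scalar Unit) (fun j => ![1, s] (σ j)), ← List.map_ofFn,
      ← map_list_prod, List.prod_ofFn]
    simp [productVec, Matrix.trace]
  | succ k ih =>
    obtain ⟨I, _, _, X, Y, X', Y', h1, h2, h3, h4⟩ := ih
    have hP := idemP_mul_self ha hb hs hsq hsusy
    have hG := idemG_mul_self (ε := -1) ha hb hs (by norm_num) hsq
    have hG' := idemG_mul_self (ε := 1) ha hb hs (by norm_num) hsq
    have htP : (idemP a b c d s).trace = 1 := by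
      rw [idemP, Matrix.trace_fin_two_of]; norm_num
    have htG : ∀ ε, (idemG a b c d s ε).trace = 1 := fun ε => by
      rw [idemG, Matrix.trace_fin_two_of]; field_simp
    refine ⟨Fin 2 × I, inferInstance, inferInstance, _, _, _, _, h1.kronecker hP hG hG',
      h2.kronecker hP hG hG', ?_, ?_⟩
    · rw [trace_sub] at h3
      simp only [trace_sub, trace_add, trace_kronecker, htP, htG]
      rw [pow_succ]
      linear_combination -h3
    · rw [pow_succ', ← Matrix.mulVec_mulVec, h4, transferMatrix_mulVec_matrixProductState]
      congr 1
      funext σ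
      rw [sum_auxBlock_kronecker_localMatrix a b c d hab hs.ne']
      generalize idemP a b c d s = P
      generalize idemG a b c d s 1 = G'
      generalize idemG a b c d s (-1) = G
      ext i j
      simp only [localMatrix, Matrix.kroneckerMap_apply, Matrix.add_apply, Matrix.sub_apply,
        Matrix.smul_apply, smul_eq_mul, pow_succ]
      ring

/-- The pairing is the trace of the `(2 n + 1)`-st power of `± (a + b) ^ k` times a difference of
idempotents, whose trace does not change under odd powers. -/
theorem dotProduct_transferMatrix_pow_mulVec {a b c d s : ℝ} (ha : 0 < a) (hb : 0 < b)
    (hs : 0 < s) (hsq : s ^ 2 * (a * b) = c * d)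
    (hsusy : (a ^ 2 + a * b) * (b ^ 2 + a * b) = (c ^ 2 + a * b) * (d ^ 2 + a * b)) (n k : ℕ) :
    productCovec (2 * n + 1) s ⬝ᵥ (transferMatrix (2 * n + 1) a b c d ^ k *ᵥ
      productVec (2 * n + 1) s) = ((a + b) ^ (2 * n + 1)) ^ k := by
  obtain ⟨I, _, _, X, Y, X', Y', h1, h2, h3, h4⟩ :=
    exists_transferMatrix_pow_mulVec ha hb hs hsq hsusy (2 * n + 1) k
  have hloc : ∀ D E : Matrix I I ℝ,
      ∑ σ, (![1 / 2, 1 / (2 * s)] : Fin 2 → ℝ) σ • localMatrix s D E σ = D := by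
    intro D E
    ext i j
    simp [Fin.sum_univ_two, localMatrix]
    field_simp
    ring
  have hcov : productCovec (2 * n + 1) s = fun σ => ∏ j, ![1 / 2, 1 / (2 * s)] (σ j) := rfl
  rw [h4, hcov, dotProduct_matrixProductState, hloc, smul_pow, trace_smul,
    trace_sub_pow_of_isIdempotentElem h2.left_idem h1.left_idem, h3, smul_eq_mul, ← pow_mul,
    ← pow_mul, mul_comm k, neg_pow, mul_right_comm, ← pow_add,
    Even.neg_one_pow ⟨(n + 1) * k, by ring⟩, one_mul]

end EightVertex

open EightVertex in
theorem mainTheorem4 (n : ℕ) (hn : 1 ≤ n) (a b c d : ℝ)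
    (ha : 0 < a) (hb : 0 < b) (hc : 0 < c) (hd : 0 < d)
    (hsusy : (a ^ 2 + a * b) * (b ^ 2 + a * b) = (c ^ 2 + a * b) * (d ^ 2 + a * b)) :
    Module.End.HasEigenvalue
        (Matrix.toLin' (EightVertex.transferMatrix (2 * n + 1) (a : ℂ) (b : ℂ) (c : ℂ) (d : ℂ)))
        (((a + b) ^ (2 * n + 1) : ℝ) : ℂ) ∧
      ∀ μ : ℂ,
        Module.End.HasEigenvalue
          (Matrix.toLin' (EightVertex.transferMatrix (2 * n + 1) (a : ℂ) (b : ℂ) (c : ℂ) (d : ℂ)))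
          μ →
        μ ≠ (((a + b) ^ (2 * n + 1) : ℝ) : ℂ) → ‖μ‖ < (a + b) ^ (2 * n + 1) := by
  -- This `s` makes `idemG` idempotent, and `idemP` on the given variety of weights.
  set s : ℝ := √(c * d / (a * b)) with hs_def
  have hs : 0 < s := Real.sqrt_pos.mpr (by positivity)
  have hsq : s ^ 2 * (a * b) = c * d := by
    rw [hs_def, Real.sq_sqrt (by positivity)]
    field_simp
  have hpow' := dotProduct_transferMatrix_pow_mulVec ha hb hs hsq hsusy n
  have hone : productCovec (2 * n + 1) s ⬝ᵥ productVec (2 * n + 1) s = 1 := by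
    simpa using hpow' 0
  have hpow : ∀ k : ℕ, productCovec (2 * n + 1) s ⬝ᵥ (transferMatrix (2 * n + 1) a b c d ^ k *ᵥ
      productVec (2 * n + 1) s) = ((a + b) ^ (2 * n + 1)) ^ k *
        (productCovec (2 * n + 1) s ⬝ᵥ productVec (2 * n + 1) s) := fun k => by
    rw [hpow', hone, mul_one]
  have hφ : ∀ σ, 0 < productCovec (2 * n + 1) s σ := fun σ =>
    Finset.prod_pos fun j _ => by
      generalize σ j = τ
      fin_cases τ <;> simp [hs]
  have hv : ∀ σ, 0 < productVec (2 * n + 1) s σ := fun σ =>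
    Finset.prod_pos fun j _ => by
      generalize σ j = τ
      fin_cases τ <;> simp [hs]
  have hmap : transferMatrix (2 * n + 1) (a : ℂ) (b : ℂ) (c : ℂ) (d : ℂ)
      = (transferMatrix (2 * n + 1) a b c d).map Complex.ofRealHom :=
    (transferMatrix_map Complex.ofRealHom (2 * n + 1) a b c d).symm
  rw [hmap]
  refine ⟨?_, fun μ hμ hne => ?_⟩
  · refine hasEigenvalue_of_dotProduct_pow (φ := Complex.ofRealHom ∘ productCovec (2 * n + 1) s)
      (v := Complex.ofRealHom ∘ productVec (2 * n + 1) s) ?_ fun k => ?_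
    · rw [← RingHom.map_dotProduct, hone, map_one]
      exact one_ne_zero
    · have h := congrArg Complex.ofRealHom (hpow k)
      rw [RingHom.map_dotProduct, map_mul, RingHom.map_dotProduct, map_pow] at h
      refine Eq.trans ?_ h
      rw [← RingHom.mapMatrix_apply, ← map_pow]
      congr 1
      ext σ
      exact (RingHom.map_mulVec _ _ _ σ).symm
  · exact norm_eigenvalue_lt_of_dotProduct_pow (transferMatrix_nonneg ha hb hc hd _)
      (transferMatrix_diag_pos ha hb hc hd _) hφ hv hpow hμ hne
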